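/- **Conventions.** Let $L$ be a countable language with only function symbols (constants included) and let $\mathbf V$ be a variety of $L$-algebras. A $\mathbf V$-free algebra of rank $\lambda$ is an algebra of $\mathbf V$ freely generated in $\mathbf V$ by a set of size $\lambda$ (rank $0$ is allowed). $\mathcal F_{\mathbf V}$, $\mathcal F^{\infty}_{\mathbf V}$, $\mathcal F^{<\infty}_{\mathbf V}$ are the classes of $\mathbf V$-free algebras, of those of infinite rank, and of those of finite rank. $A*C$ and $B*_AC$ denote the coproduct and the pushout over $A$ in $\mathbf V$; $\le$ is the substructure relation. For $A,B\in\mathcal F_{\mathbf V}$, $A\leqslant_*^{\rm ff}B$ means that $B=A*C$ (as an internal free product) for some $C\in\mathcal F_{\mathbf V}$. $\mathbf V$ satisfies the *Construction Principle* if there are countable $A\le B$ in $\mathcal F^\infty_{\mathbf V}$ with $A$ freely generated by $\{a_i:i<\omega\}$ such that $\langle a_j:j\le i\rangle_B\leqslant_*^{\rm ff}B$ for every $i<\omega$, and $A\not\leqslant_*^{\rm ff}B*C$ for every $C\in\mathcal F_{\mathbf V}$. An *AEC-covering* of $(\mathcal F_{\mathbf V},\leqslant_*^{\rm ff})$ is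 an abstract elementary class $(\mathcal K,\preccurlyeq)$ of $L$-structures with the amalgamation and joint embedding properties such that $\mathcal F^\infty_{\mathbf V}\subseteq\mathcal K$ and, for $A,B\in\mathcal F_{\mathbf V}\cap\mathcal K$, $A\leqslant_*^{\rm ff}B$ implies $A\preccurlyeq B$. Let $\kappa>\mathrm{LS}(\mathcal K,\preccurlyeq)$, and let $\mathfrak M\in\mathcal K$ be a *monster model*: every $C\in\mathcal K$ with $|C|\le\kappa$ embeds strongly in $\mathfrak M$, and every isomorphism between strong submodels of $\mathfrak M$ of size $<\kappa$ extends to an automorphism of $\mathfrak M$. Below, "model" means a strong submodel of $\mathfrak M$ of size $<\kappa$, and $\mathrm{tp}(\bar a/A)=\mathrm{tp}(\bar b/A)$ means that some automorphism of $\mathfrak M$ fixing $A$ pointwise maps $\bar a$ to $\bar b$. A *weak independence calculus* is a relation $\bar a\perp_{A}B$ between finite tuples $\bar a$ of $\mathfrak M$ and models $A\preccurlyeq B$ such that: 1. (Invariance) if $\bar a\perp_AB$ and $f\in\mathrm{Aut}(\mathfrak M)$, then $f(\bar a)\perp_{f(A)}f(B)$; 2. (Disjointness) if $\bar a\perp_AB$,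 then $\bar a\in B$ iff $\bar a\in A$; 3. (Symmetry) if $\bar b\perp_{A_0}A_1$ and $\bar a\in A_1$, there is a model $A_2\succcurlyeq A_0$ with $\bar b\in A_2$ and $\bar a\perp_{A_0}A_2$; 4. (Monotonicity) if $A\preccurlyeq A'\preccurlyeq B'\preccurlyeq B$ and $\bar a\perp_AB$, then $\bar a\perp_{A'}B'$; 5. (Existence) for $A\preccurlyeq B$ and every $\bar a$ there is $\bar b$ with $\mathrm{tp}(\bar b/A)=\mathrm{tp}(\bar a/A)$ and $\bar b\perp_AB$; 6. (Uniqueness) if $\bar a\perp_AB$, $\bar b\perp_AB$ and $\mathrm{tp}(\bar a/A)=\mathrm{tp}(\bar b/A)$, then $\mathrm{tp}(\bar a/B)=\mathrm{tp}(\bar b/B)$; 7. (Continuity) if $\delta$ is a limit ordinal, $(A_i)_{i\le\delta}$ is an increasing continuous $\preccurlyeq$-chain of models, and $\bar a_i\perp_{A_0}A_i$ and $\mathrm{tp}(\bar a_i/A_i)=\mathrm{tp}(\bar a/A_i)$ for all $i<\delta$, then $\bar a\perp_{A_0}A_\delta$. It is *superstable* if moreover for every limit ordinal $\delta$, every increasing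 continuous $\preccurlyeq$-chain $(A_i)_{i\le\delta}$ of models and every finite tuple $\bar a$ of $\mathfrak M$ there is $\alpha<\delta$ with $\bar a\perp_{A_\alpha}A_\delta$. For models $A,B,C$ write $B\perp_AC$ if $\bar b\perp_AC$ for every finite tuple $\bar b$ of $B$, and $B\perp^*_AC$ if $\langle B,C\rangle_{\mathfrak M}=B*_AC$ (as an internal free amalgam) and $\langle B,C\rangle_{\mathfrak M}\preccurlyeq\mathfrak M$. The calculus is *nice with respect to free factors* if: - $(\star_1)$ there is $n_*<\omega$ such that the $\mathbf V$-free algebras of rank $m$ are in $\mathcal K$ whenever $n_*\le m<\omega$; - $(\star_2)$ there is $m_*<\omega$ such that, for all models $A,B,C\in\mathcal F_{\mathbf V}$ with $A\leqslant_*^{\rm ff}B$, $A\leqslant_*^{\rm ff}C$ and $A$ of rank at least $m_*$, $B\perp_AC$ iff $B\perp^*_AC$; - $(\star_3)$ for all models $A\in\mathcal F^{<\infty}_{\mathbf V}$ and $B,C\in\mathcal F_{\mathbf V}$ with $A\preccurlyeq B$ and $A\leqslant_*^{\rm ff}C$, and every $c\in C$ with $c\perp_AB$, there is $D\in\mathcal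 F^{<\infty}_{\mathbf V}$ with $c\in D$, $A\leqslant_*^{\rm ff}D\leqslant_*^{\rm ff}C$ and $D\perp_AB$; - $(\star_4)$ for all models $A,B,C\in\mathcal F^{<\infty}_{\mathbf V}$ and $D\in\mathcal F_{\mathbf V}$ with $A\leqslant_*^{\rm ff}B\leqslant_*^{\rm ff}D$, $A\leqslant_*^{\rm ff}C\leqslant_*^{\rm ff}D$ and $B\perp_AC$, one has $\langle B,C\rangle_{\mathfrak M}=B*_AC\leqslant_*^{\rm ff}D$. **Theorem.** Let $\mathbf V$ be a variety in a countable language satisfying the Construction Principle, and let $(\mathcal K,\preccurlyeq)$ be an AEC-covering of $(\mathcal F_{\mathbf V},\leqslant_*^{\rm ff})$ with a weak independence calculus $\perp$ (in a monster model $\mathfrak M$ as above) which is nice with respect to free factors. Then $\perp$ is not superstable. -/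

import Mathlib

open FirstOrder Cardinal

universe u v w

/-! ### Varieties of algebras and their free objects -/

/-- A variety of algebras in the language `L`, presented by its identities.  (The language is
assumed to be algebraic wherever a variety occurs in the theorem.) -/
structure AlgVariety (L : FirstOrder.Language.{v, w}) where
  identities : Set (L.Term ℕ × L.Term ℕ)

namespace AlgVariety

variable {L : FirstOrder.Language.{v, w}} (V : AlgVariety L)

/-- The algebra `M` belongs to the variety `V`. -/
def Mem (M : Type u) [L.Structure M] : Prop :=
  ∀ e ∈ V.identities, ∀ x : ℕ → M, e.1.realize x = e.2.realize x

/-- `M` is an algebra of `V`, freely generated in `V` by the set `X`. -/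
def IsBasis (M : Type u) [L.Structure M] (X : Set M) : Prop :=
  V.Mem M ∧ FirstOrder.Language.Substructure.closure L X = ⊤ ∧
    ∀ (N : Type u) [L.Structure N], V.Mem N →
      ∀ f : X → N, ∃ h : M →[L] N, ∀ x : X, h x = f x

/-- `M` is a `V`-free algebra (of some rank, possibly `0`). -/
def IsFree (M : Type u) [L.Structure M] : Prop :=
  ∃ X : Set M, V.IsBasis M X

/-- `M` is a `V`-free algebra of infinite rank. -/
def IsFreeInf (M : Type u) [L.Structure M] : Prop :=
  ∃ X : Set M, V.IsBasis M X ∧ X.Infinite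

/-- `M` is a `V`-free algebra of finite rank. -/
def IsFreeFin (M : Type u) [L.Structure M] : Prop :=
  ∃ X : Set M, V.IsBasis M X ∧ X.Finite

/-- `M` is a `V`-free algebra of rank `m`. -/
def IsFreeOfRank (M : Type u) [L.Structure M] (m : ℕ) : Prop :=
  ∃ X : Set M, V.IsBasis M X ∧ X.encard = m

/-- `M` is a `V`-free algebra of rank at least `m`. -/
def IsFreeOfRankGE (M : Type u) [L.Structure M] (m : ℕ) : Prop :=
  ∃ X : Set M, V.IsBasis M X ∧ (m : ℕ∞) ≤ X.encard

/-- Inside an ambient structure `M`: the substructure `P` is the free product `A * C` in `V` of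
its substructures `A` and `C`, i.e. it is their coproduct in `V` along the inclusions.
(Uniqueness of the mediating map is automatic, as `P` is generated by `A` and `C`.) -/
def IsFreeProduct {M : Type u} [L.Structure M] (A C P : L.Substructure M) : Prop :=
  V.Mem P ∧ A ⊔ C = P ∧
    ∀ (N : Type u) [L.Structure N], V.Mem N → ∀ (f : A →[L] N) (g : C →[L] N),
      ∃ h : P →[L] N,
        (∀ (x : M) (hA : x ∈ A) (hP : x ∈ P), h ⟨x, hP⟩ = f ⟨x, hA⟩) ∧
        (∀ (x : M) (hC : x ∈ C) (hP : x ∈ P), h ⟨x, hP⟩ = g ⟨x, hC⟩)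

/-- Inside an ambient structure `M`: the substructure `P` is the free product `B *_A C` in `V` of
its substructures `B` and `C` with amalgamated common substructure `A`, i.e. it is the pushout
in `V` of the inclusions of `A` in `B` and `C`. -/
def IsFreeAmalgam {M : Type u} [L.Structure M] (A B C P : L.Substructure M) : Prop :=
  A ≤ B ∧ A ≤ C ∧ V.Mem P ∧ B ⊔ C = P ∧
    ∀ (N : Type u) [L.Structure N], V.Mem N → ∀ (f : B →[L] N) (g : C →[L] N),
      (∀ (x : M) (hB : x ∈ B) (hC : x ∈ C), x ∈ A → f ⟨x, hB⟩ = g ⟨x, hC⟩) →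
      ∃ h : P →[L] N,
        (∀ (x : M) (hB : x ∈ B) (hP : x ∈ P), h ⟨x, hP⟩ = f ⟨x, hB⟩) ∧
        (∀ (x : M) (hC : x ∈ C) (hP : x ∈ P), h ⟨x, hP⟩ = g ⟨x, hC⟩)

/-- The free algebra `A` is a free factor of the free algebra `B` with a free complementary
factor: `B = A * C` for some free algebra `C`. -/
def FreeFactor {M : Type u} [L.Structure M] (A B : L.Substructure M) : Prop :=
  V.IsFree A ∧ V.IsFree B ∧ ∃ C : L.Substructure M, V.IsFree C ∧ V.IsFreeProduct A C B

/-- The Construction Principle: there are countable free algebras `A ≤ B` of infinite rank with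
`A` freely generated by `a 0, a 1, …`, such that every `⟨a j : j ≤ i⟩` is a free factor of `B`
(with free complement), but `A` is not a free factor of `B * C`, for any free algebra `C`.
The free product `B * C` is any algebra `P` which is the internal free product of an embedded
copy of `B` and a free subalgebra `C`. -/
def ConstructionPrinciple : Prop :=
  ∃ (B : Type u) (_ : L.Structure B) (A : L.Substructure B) (a : ℕ → A),
    Countable B ∧ V.IsFreeInf B ∧
    Function.Injective a ∧ V.IsBasis A (Set.range a) ∧
    (∀ i : ℕ, V.FreeFactor
      (FirstOrder.Language.Substructure.closure L {x : B | ∃ j ≤ i, x = (a j : B)}) ⊤) ∧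
    ∀ (P : Type u) [L.Structure P] (f : B ↪[L] P) (C : L.Substructure P),
      V.IsFree C → V.IsFreeProduct f.toHom.range C ⊤ →
        ¬ V.FreeFactor (A.map f.toHom) ⊤

end AlgVariety

/-! ### Abstract elementary classes -/

/-- A class of `L`-structures together with a relation between structures and their
substructures: `mem M` says that `M` is in the class, `strong M A` that `A ≼ M`. -/
structure StrongClass (L : FirstOrder.Language.{v, w}) where
  mem : ∀ (M : Type u) [L.Structure M], Prop
  strong : ∀ (M : Type u) [L.Structure M], L.Substructure M → Prop

namespace StrongClass

variable {L : FirstOrder.Language.{v, w}} (K : StrongClass.{u} L)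

/-- `A ≼ B` for two substructures `A`, `B` of an ambient structure. -/
def StrongIn {M : Type u} [L.Structure M] (A B : L.Substructure M) : Prop :=
  A ≤ B ∧ K.strong B (A.comap B.subtype.toHom)

/-- A strong embedding: its image is a strong substructure. -/
def IsStrongEmbedding {M N : Type u} [L.Structure M] [L.Structure N] (f : M ↪[L] N) : Prop :=
  K.strong N f.toHom.range

/-- `(A i)_{i < δ}` is an increasing continuous `≼`-chain of structures in `K`
(the values `A i` for `i ≥ δ` are irrelevant). -/
structure IsContinuousChain {M : Type u} [L.Structure M] (δ : Ordinal.{u})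
    (A : Ordinal.{u} → L.Substructure M) : Prop where
  mem : ∀ i < δ, K.mem (A i)
  strongIn : ∀ i j, i ≤ j → j < δ → K.StrongIn (A i) (A j)
  continuous : ∀ j < δ, Order.IsSuccLimit j → (A j : Set M) = ⋃ i < j, (A i : Set M)

/-- `lam` is a Löwenheim-Skolem number of `K`. -/
def IsLSNumber (lam : Cardinal.{u}) : Prop :=
  ℵ₀ ≤ lam ∧ Cardinal.lift.{u} L.card ≤ Cardinal.lift.{max v w} lam ∧
    ∀ (M : Type u) [L.Structure M], K.mem M → ∀ X : Set M,
      ∃ C : L.Substructure M, X ⊆ C ∧ K.strong M C ∧ #C ≤ #X + lam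

/-- `K` is an abstract elementary class.  That `A ≼ M` implies that `A` is a substructure of `M`
is built into the type of `K.strong`, and so is antisymmetry. -/
structure IsAEC : Prop where
  mem_of_strong : ∀ (M : Type u) [L.Structure M] (A : L.Substructure M),
    K.strong M A → K.mem M ∧ K.mem A
  mem_iso : ∀ (M N : Type u) [L.Structure M] [L.Structure N], (M ≃[L] N) → K.mem M → K.mem N
  strong_iso : ∀ (M N : Type u) [L.Structure M] [L.Structure N] (f : M ≃[L] N)
    (A : L.Substructure M), K.strong M A → K.strong N (A.map f.toHom)
  refl : ∀ (M : Type u) [L.Structure M], K.mem M → K.strong M ⊤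
  trans : ∀ (M : Type u) [L.Structure M] (A B : L.Substructure M),
    K.StrongIn A B → K.strong M B → K.strong M A
  /-- The Tarski-Vaught axioms; `U` is the union of the chain. -/
  union : ∀ (M : Type u) [L.Structure M] (δ : Ordinal.{u}) (A : Ordinal.{u} → L.Substructure M)
    (U : L.Substructure M), Order.IsSuccLimit δ → K.IsContinuousChain δ A →
    (U : Set M) = ⋃ i < δ, (A i : Set M) →
      K.mem U ∧ (∀ j < δ, K.StrongIn (A j) U) ∧
      ((∀ i < δ, K.strong M (A i)) → K.strong M U)
  coherence : ∀ (M : Type u) [L.Structure M] (A B : L.Substructure M),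
    K.strong M A → K.strong M B → A ≤ B → K.StrongIn A B
  exists_isLSNumber : ∃ lam : Cardinal.{u}, K.IsLSNumber lam

/-- The amalgamation property. -/
def AP : Prop :=
  ∀ (A B C : Type u) [L.Structure A] [L.Structure B] [L.Structure C]
    (f : A ↪[L] B) (g : A ↪[L] C), K.mem A → K.IsStrongEmbedding f → K.IsStrongEmbedding g →
    ∃ (D : Type u) (_ : L.Structure D) (f' : B ↪[L] D) (g' : C ↪[L] D),
      K.IsStrongEmbedding f' ∧ K.IsStrongEmbedding g' ∧ ∀ x, f' (f x) = g' (g x)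

/-- The joint embedding property. -/
def JEP : Prop :=
  ∀ (B C : Type u) [L.Structure B] [L.Structure C], K.mem B → K.mem C →
    ∃ (D : Type u) (_ : L.Structure D) (f : B ↪[L] D) (g : C ↪[L] D),
      K.IsStrongEmbedding f ∧ K.IsStrongEmbedding g

/-- `(K, ≼)` is an AEC-covering of the free algebras of `V` with the relation of being a free
factor with free complement. -/
structure IsAECCovering (V : AlgVariety L) : Prop where
  mem_of_isFreeInf : ∀ (M : Type u) [L.Structure M], V.IsFreeInf M → K.mem M
  isAEC : K.IsAEC
  strongIn_of_freeFactor : ∀ (M : Type u) [L.Structure M] (A B : L.Substructure M),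
    K.mem A → K.mem B → V.FreeFactor A B → K.StrongIn A B
  ap : K.AP
  jep : K.JEP

/-! ### The monster model and independence calculi -/

/-- `M` is a `(κ, ≼)`-universal and `(κ, ≼)`-homogeneous model in `K`. -/
structure IsMonster (κ : Cardinal.{u}) (M : Type u) [L.Structure M] : Prop where
  mem : K.mem M
  universal : ∀ (C : Type u) [L.Structure C], K.mem C → #C ≤ κ →
    ∃ f : C ↪[L] M, K.IsStrongEmbedding f
  homogeneous : ∀ (A₀ A₁ : L.Substructure M), K.strong M A₀ → K.strong M A₁ →
    #A₀ < κ → #A₁ < κ → ∀ f : A₀ ≃[L] A₁, ∃ π : M ≃[L] M, ∀ x : A₀, π x = f x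

/-- `A` is a strong submodel of `M` of size less than `κ`.  As usual when working in a monster
model, "strong submodel of the monster" refers to these. -/
def Small (κ : Cardinal.{u}) {M : Type u} [L.Structure M] (A : L.Substructure M) : Prop :=
  K.strong M A ∧ #A < κ

end StrongClass

/-- The tuples `a` and `b` have the same Galois type over `A` in the monster model `M`: they are
in the same orbit of the automorphisms of `M` that fix `A` pointwise. -/
def SameGaloisType {L : FirstOrder.Language.{v, w}} {M : Type u} [L.Structure M] {n : ℕ}
    (A : L.Substructure M) (a b : Fin n → M) : Prop :=
  ∃ f : M ≃[L] M, (∀ x ∈ A, f x = x) ∧ ∀ i, f (a i) = b i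

/-- A ternary relation between finite tuples of `M` and two substructures of `M`;
`ind a A B` stands for: `a` is independent from `B` over `A`. -/
abbrev TernaryRel (L : FirstOrder.Language.{v, w}) (M : Type u) [L.Structure M] : Type u :=
  ∀ ⦃n : ℕ⦄, (Fin n → M) → L.Substructure M → L.Substructure M → Prop

/-- `(K, ≼, ind)` is a weak independence calculus, computed in the monster model `M`.  The
relation is only considered for tuples and pairs `A₀ ≼ A₁` of (small) strong submodels of `M`.
By coherence, `A₀ ≼ A₁` amounts to `A₀ ≤ A₁` for such submodels. -/
structure IsWeakIndependenceCalculus {L : FirstOrder.Language.{v, w}} (K : StrongClass.{u} L)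
    (κ : Cardinal.{u}) (M : Type u) [L.Structure M] (ind : TernaryRel L M) : Prop where
  invariance : ∀ (n : ℕ) (a : Fin n → M) (A₀ A₁ : L.Substructure M) (f : M ≃[L] M),
    K.Small κ A₀ → K.Small κ A₁ → K.StrongIn A₀ A₁ →
    ind a A₀ A₁ → ind (fun i => f (a i)) (A₀.map f.toHom) (A₁.map f.toHom)
  disjointness : ∀ (n : ℕ) (a : Fin n → M) (A₀ A₁ : L.Substructure M),
    K.Small κ A₀ → K.Small κ A₁ → K.StrongIn A₀ A₁ →
    ind a A₀ A₁ → ((∀ i, a i ∈ A₁) ↔ ∀ i, a i ∈ A₀)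
  symmetry : ∀ (m n : ℕ) (a : Fin m → M) (b : Fin n → M) (A₀ A₁ : L.Substructure M),
    K.Small κ A₀ → K.Small κ A₁ → K.StrongIn A₀ A₁ →
    ind b A₀ A₁ → (∀ i, a i ∈ A₁) →
    ∃ A₂ : L.Substructure M, K.Small κ A₂ ∧ K.StrongIn A₀ A₂ ∧ (∀ i, b i ∈ A₂) ∧ ind a A₀ A₂
  monotonicity : ∀ (n : ℕ) (a : Fin n → M) (A A' B' B : L.Substructure M),
    K.Small κ A → K.Small κ A' → K.Small κ B' → K.Small κ B →
    K.StrongIn A A' → K.StrongIn A' B' → K.StrongIn B' B →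
    ind a A B → ind a A' B'
  existence : ∀ (n : ℕ) (a : Fin n → M) (A B : L.Substructure M),
    K.Small κ A → K.Small κ B → K.StrongIn A B →
    ∃ b : Fin n → M, SameGaloisType A a b ∧ ind b A B
  uniqueness : ∀ (n : ℕ) (a b : Fin n → M) (A B : L.Substructure M),
    K.Small κ A → K.Small κ B → K.StrongIn A B →
    ind a A B → ind b A B → SameGaloisType A a b → SameGaloisType B a b
  continuity : ∀ (n : ℕ) (δ : Ordinal.{u}) (A : Ordinal.{u} → L.Substructure M)
    (a : Fin n → M) (a' : Ordinal.{u} → Fin n → M),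
    Order.IsSuccLimit δ → K.IsContinuousChain δ A →
    (A δ : Set M) = ⋃ i < δ, (A i : Set M) → K.Small κ (A δ) →
    (∀ i < δ, ind (a' i) (A 0) (A i) ∧ SameGaloisType (A i) (a' i) a) →
    ind a (A 0) (A δ)

/-- Superstable local character, the condition that makes a weak independence calculus a
superstable one. -/
def SuperstableLocalCharacter {L : FirstOrder.Language.{v, w}} (K : StrongClass.{u} L)
    (κ : Cardinal.{u}) (M : Type u) [L.Structure M] (ind : TernaryRel L M) : Prop :=
  ∀ (n : ℕ) (δ : Ordinal.{u}) (A : Ordinal.{u} → L.Substructure M) (a : Fin n → M),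
    Order.IsSuccLimit δ → K.IsContinuousChain δ A →
    (A δ : Set M) = ⋃ i < δ, (A i : Set M) → K.Small κ (A δ) →
    ∃ α < δ, ind a (A α) (A δ)

/-- `B` is independent from `C` over `A`: so is every finite tuple of elements of `B`. -/
def IndStructure {L : FirstOrder.Language.{v, w}} {M : Type u} [L.Structure M] (ind : TernaryRel L M)
    (B A C : L.Substructure M) : Prop :=
  ∀ (n : ℕ) (b : Fin n → M), (∀ i, b i ∈ B) → ind b A C

/-- Free independence: `⟨B, C⟩` is the free amalgam `B *_A C` and a strong submodel of `M`. -/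
def FreeInd {L : FirstOrder.Language.{v, w}} (V : AlgVariety L) (K : StrongClass.{u} L)
    {M : Type u} [L.Structure M] (B A C : L.Substructure M) : Prop :=
  V.IsFreeAmalgam A B C (B ⊔ C) ∧ K.strong M (B ⊔ C)

/-- The calculus `(K, ≼, ind)` in the monster model `M` is nice with respect to free factors. -/
structure IsNiceFreeFactors {L : FirstOrder.Language.{v, w}} (V : AlgVariety L) (K : StrongClass.{u} L)
    (κ : Cardinal.{u}) (M : Type u) [L.Structure M] (ind : TernaryRel L M) : Prop where
  star1 : ∃ n : ℕ, ∀ m : ℕ, n ≤ m →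
    ∀ (F : Type u) [L.Structure F], V.IsFreeOfRank F m → K.mem F
  star2 : ∃ m : ℕ, ∀ A B C : L.Substructure M,
    K.Small κ A → K.Small κ B → K.Small κ C →
    V.FreeFactor A B → V.FreeFactor A C → V.IsFreeOfRankGE A m →
    (IndStructure ind B A C ↔ FreeInd V K B A C)
  star3 : ∀ A B C : L.Substructure M,
    K.Small κ A → K.Small κ B → K.Small κ C →
    V.IsFreeFin A → V.IsFree B → V.IsFree C → K.StrongIn A B → V.FreeFactor A C →
    ∀ c ∈ C, ind ![c] A B →
      ∃ D : L.Substructure M, V.IsFreeFin D ∧ c ∈ D ∧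
        V.FreeFactor A D ∧ V.FreeFactor D C ∧ IndStructure ind D A B
  star4 : ∀ A B C D : L.Substructure M,
    K.Small κ A → K.Small κ B → K.Small κ C → K.Small κ D →
    V.IsFreeFin A → V.IsFreeFin B → V.IsFreeFin C → V.IsFree D →
    V.FreeFactor A B → V.FreeFactor B D → V.FreeFactor A C → V.FreeFactor C D →
    IndStructure ind B A C →
      V.IsFreeAmalgam A B C (B ⊔ C) ∧ V.FreeFactor (B ⊔ C) D

/-!
Under superstable local character, an increasing sequence `X 0 ⊆ X 1 ⊆ ⋯` of finite parts of
bases of a countable free algebra `B` has a union that is again part of a basis of `B`, which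
the Construction Principle forbids.  Indeed, local character makes any given `b ∈ B` independent
of `⟨⋃ j, X j⟩` over some `⟨X m⟩`; `(⋆₃)` then places `b` in a free factor `⟨Z⟩` with a finite
basis `Z ⊇ X m` and the same independence, and by `(⋆₄)` every `X j ∪ Z` with `j ≥ m` is still
part of a basis.  So a finite set that completes almost all `X j` to parts of bases can be
enlarged so as to absorb `b`, and doing so for every `b` in turn completes `⋃ j, X j` to a basis.
-/

open FirstOrder.Language FirstOrder.Language.Substructure Filter

section Substructure

variable {L : FirstOrder.Language.{v, w}} {M N : Type u} [L.Structure M] [L.Structure N]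

theorem map_subtype_top (S : L.Substructure M) :
    (⊤ : L.Substructure S).map S.subtype.toHom = S := by
  rw [← Hom.range_eq_map, range_subtype]

theorem closure_image_coe_eq_iff {S : L.Substructure M} {Y : Set S} :
    closure L (((↑) : S → M) '' Y) = S ↔ closure L Y = ⊤ := by
  have hmap : (closure L Y).map S.subtype.toHom = closure L (((↑) : S → M) '' Y) := map_closure _ _
  rw [← (map_injective_of_injective (f := S.subtype.toHom) S.subtype_injective).eq_iff, hmap,
    map_subtype_top]

theorem hom_closure_ext {X : Set M} {f g : closure L X →[L] N}
    (h : ∀ x (hx : x ∈ X), f ⟨x, subset_closure hx⟩ = g ⟨x, subset_closure hx⟩) : f = g := by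
  have htop : closure L (((↑) : closure L X → M) ⁻¹' X) = ⊤ := by
    rw [← closure_image_coe_eq_iff, Set.image_preimage_eq_of_subset]
    exact Substructure.subset_closure.trans Subtype.range_coe.ge
  exact Hom.eq_of_eqOn_dense htop fun x hx => h x hx

theorem exists_finite_subset_mem_closure {Y : Set M} {x : M} (hx : x ∈ closure L Y) :
    ∃ Z ⊆ Y, Z.Finite ∧ x ∈ closure L Z := by
  refine Substructure.closure_induction
    (p := fun x => ∃ Z ⊆ Y, Z.Finite ∧ x ∈ Substructure.closure L Z) hx (fun y hy => ?_)
    fun F v hv => ?_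
  · exact ⟨{y}, Set.singleton_subset_iff.2 hy, Set.finite_singleton y,
      subset_closure rfl⟩
  · choose Z hZY hZ hvZ using (hv : ∀ i, ∃ Z ⊆ Y, Z.Finite ∧ v i ∈ closure L Z)
    exact ⟨⋃ i, Z i, Set.iUnion_subset hZY, Set.finite_iUnion hZ,
      (Substructure.closure L _).fun_mem F v fun i => closure_mono (Set.subset_iUnion Z i) (hvZ i)⟩

theorem exists_finite_subset_subset_closure {F Y : Set M} (hF : F.Finite) (h : F ⊆ closure L Y) :
    ∃ Z ⊆ Y, Z.Finite ∧ F ⊆ closure L Z := by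
  choose! Z hZY hZ hxZ using fun x hx => exists_finite_subset_mem_closure (h (a := x) hx)
  exact ⟨⋃ x ∈ F, Z x, Set.iUnion₂_subset hZY, hF.biUnion hZ, fun x hx =>
    closure_mono (Set.subset_biUnion_of_mem (u := Z) hx) (hxZ x hx)⟩

theorem coe_iSup_of_monotone {E : ℕ → L.Substructure M} (hE : Monotone E) :
    ((⨆ n, E n : L.Substructure M) : Set M) = ⋃ n, (E n : Set M) := by
  ext x
  simp only [SetLike.mem_coe, mem_iSup_of_directed hE.directed_le, Set.mem_iUnion]

end Substructure

namespace AlgVariety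

variable {L : FirstOrder.Language.{v, w}} (V : AlgVariety L)

section Independence

/-- The set `X` is independent with respect to `V`: every equation between terms in elements of
`X` that holds in `M` holds under all assignments of `X` in algebras of `V`. -/
def IsIndep {M : Type u} [L.Structure M] (X : Set M) : Prop :=
  ∀ (N : Type u) [L.Structure N], V.Mem N → ∀ (f : X → N) (s t : L.Term X),
    s.realize ((↑) : X → M) = t.realize ((↑) : X → M) → s.realize f = t.realize f

variable {V} {M N : Type u} [L.Structure M] [L.Structure N] {X Y : Set M}

theorem Mem.of_embedding (f : M ↪[L] N) (hN : V.Mem N) : V.Mem M := fun e he x =>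
  f.injective <| by simpa only [← HomClass.realize_term] using hN e he (f ∘ x)

theorem Mem.of_le {S T : L.Substructure M} (hT : V.Mem T) (h : S ≤ T) : V.Mem S :=
  hT.of_embedding (inclusion h)

theorem mem_map_iff (f : M ↪[L] N) {S : L.Substructure M} : V.Mem (S.map f.toHom) ↔ V.Mem S :=
  ⟨fun h => h.of_embedding (f.substructureEquivMap S).toEmbedding,
    fun h => h.of_embedding (f.substructureEquivMap S).symm.toEmbedding⟩

theorem IsIndep.exists_hom [L.IsAlgebraic] (hX : V.IsIndep X) (hN : V.Mem N) (f : X → N) :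
    ∃ h : closure L X →[L] N, ∀ x : X, h ⟨x, subset_closure x.2⟩ = f x := by
  choose T hT using fun x : closure L X => mem_closure_iff_exists_term.1 x.2
  refine ⟨⟨fun x => (T x).realize f, fun {n} F x => ?_, fun {n} r => isEmptyElim r⟩, fun x => ?_⟩
  · refine hX N hN f _ (Term.func F fun i => T (x i)) ?_
    simp only [hT, Term.realize_func]
    rfl
  · exact hX N hN f _ (Term.var x) (hT _)

theorem isIndep_of_exists_hom {S : L.Substructure M} (hXS : X ⊆ S)
    (h : ∀ (N : Type u) [L.Structure N], V.Mem N → ∀ f : X → N,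
      ∃ g : S →[L] N, ∀ x : X, g ⟨x, hXS x.2⟩ = f x) : V.IsIndep X := by
  intro N _ hN f s t hst
  obtain ⟨g, hg⟩ := h N hN f
  obtain rfl : g ∘ (fun x : X => (⟨x, hXS x.2⟩ : S)) = f := funext hg
  rw [HomClass.realize_term g, HomClass.realize_term g]
  refine congrArg g (S.subtype_injective ?_)
  rwa [← HomClass.realize_term S.subtype, ← HomClass.realize_term S.subtype]

theorem IsIndep.mono (hY : V.IsIndep Y) (h : X ⊆ Y) : V.IsIndep X := by
  intro N _ hN f s t hst
  have : Nonempty N := ⟨s.realize f⟩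
  obtain ⟨g, rfl⟩ : ∃ g : Y → N, g ∘ Set.inclusion h = f :=
    (Set.inclusion_injective h).surjective_comp_right f
  have hreal := hY N hN g (s.relabel (Set.inclusion h)) (t.relabel (Set.inclusion h))
  simp only [Term.realize_relabel] at hreal
  exact hreal hst

theorem isIndep_iff_forall_finite :
    V.IsIndep X ↔ ∀ Y ⊆ X, Y.Finite → V.IsIndep Y := by
  classical
  refine ⟨fun h Y hYX _ => h.mono hYX, fun h N _ hN f s t hst => ?_⟩
  let Y : Set M := (↑) '' (s.varFinset ∪ t.varFinset : Set X)
  have hYX : Y ⊆ X := Subtype.coe_image_subset X _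
  have hY : Y.Finite := (s.varFinset.finite_toSet.union t.varFinset.finite_toSet).image _
  let s' : L.Term Y := s.restrictVar fun x => ⟨x, x, Or.inl x.2, rfl⟩
  let t' : L.Term Y := t.restrictVar fun x => ⟨x, x, Or.inr x.2, rfl⟩
  have hs (P : Type u) [L.Structure P] (g : X → P) :
      s'.realize (g ∘ Set.inclusion hYX) = s.realize g := Term.realize_restrictVar g fun _ => rfl
  have ht (P : Type u) [L.Structure P] (g : X → P) :
      t'.realize (g ∘ Set.inclusion hYX) = t.realize g := Term.realize_restrictVar g fun _ => rfl
  rw [← hs, ← ht] at hst ⊢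
  exact h Y hYX hY N hN _ s' t' hst

theorem isIndep_iUnion {X : ℕ → Set M} (hX : Monotone X) (h : ∀ n, V.IsIndep (X n)) :
    V.IsIndep (⋃ n, X n) := by
  refine isIndep_iff_forall_finite.2 fun Y hY hfin => ?_
  lift Y to Finset M using hfin
  obtain ⟨n, hn⟩ := hX.directed_le.exists_mem_subset_of_finset_subset_biUnion hY
  exact (h n).mono hn

theorem isIndep_image_iff (f : M ↪[L] N) : V.IsIndep (f '' X) ↔ V.IsIndep X := by
  let e : X ≃ f '' X := Equiv.Set.image f X f.injective
  have he : ((↑) : f '' X → N) ∘ e = f ∘ ((↑) : X → M) := rfl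
  have he_symm : f ∘ ((↑) : X → M) ∘ e.symm = ((↑) : f '' X → N) := by
    rw [← Function.comp_assoc, ← he, Function.comp_assoc, e.self_comp_symm, Function.comp_id]
  refine ⟨fun h P _ hP g s t hst => ?_, fun h P _ hP g s t hst => ?_⟩
  · have hreal := h P hP (g ∘ e.symm) (s.relabel e) (t.relabel e)
    simp only [Term.realize_relabel, Function.comp_assoc, e.symm_comp_self, Function.comp_id, he,
      HomClass.realize_term f] at hreal
    exact hreal (congrArg f hst)
  · have hreal := h P hP (g ∘ e) (s.relabel e.symm) (t.relabel e.symm)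
    simp only [Term.realize_relabel, Function.comp_assoc, e.self_comp_symm,
      Function.comp_id] at hreal
    refine hreal (f.injective ?_)
    rwa [← HomClass.realize_term f, ← HomClass.realize_term f, he_symm]

end Independence

section Bases

/-- `X` is a basis of the free algebra `S`.  This is `AlgVariety.IsBasis` for a substructure `S`
of an ambient structure, with `X` a set of elements of the ambient structure. -/
structure IsBasisOf {M : Type u} [L.Structure M] (S : L.Substructure M) (X : Set M) : Prop where
  mem : V.Mem S
  isIndep : V.IsIndep X
  closure_eq : closure L X = S

/-- `X` is a primitive subset of the free algebra `B`: it is contained in a basis of `B`. -/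
def IsPrimitive {M : Type u} [L.Structure M] (B : L.Substructure M) (X : Set M) : Prop :=
  ∃ Y, X ⊆ Y ∧ V.IsBasisOf B Y

variable {V} {M N : Type u} [L.Structure M] [L.Structure N] {A B S : L.Substructure M}
  {X Y Z : Set M}

theorem IsBasisOf.subset (h : V.IsBasisOf S X) : X ⊆ S :=
  h.closure_eq ▸ subset_closure

theorem IsBasisOf.closure_of_subset (h : V.IsBasisOf S Y) (hXY : X ⊆ Y) :
    V.IsBasisOf (closure L X) X :=
  ⟨h.mem.of_le (closure_le.2 (hXY.trans h.subset)), h.isIndep.mono hXY, rfl⟩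

theorem IsPrimitive.isBasisOf_closure (h : V.IsPrimitive B X) : V.IsBasisOf (closure L X) X := by
  obtain ⟨_, hXY, hY⟩ := h
  exact hY.closure_of_subset hXY

theorem isBasisOf_map_iff (f : M ↪[L] N) :
    V.IsBasisOf (S.map f.toHom) (f '' X) ↔ V.IsBasisOf S X := by
  have hmap : closure L (f '' X) = S.map f.toHom ↔ closure L X = S := by
    rw [← (map_injective_of_injective (f := f.toHom) f.injective).eq_iff, map_closure]
    rfl
  exact ⟨fun ⟨h₁, h₂, h₃⟩ => ⟨(mem_map_iff f).1 h₁, (isIndep_image_iff f).1 h₂, hmap.1 h₃⟩,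
    fun ⟨h₁, h₂, h₃⟩ => ⟨(mem_map_iff f).2 h₁, (isIndep_image_iff f).2 h₂, hmap.2 h₃⟩⟩

theorem isPrimitive_map_iff (f : M ↪[L] N) :
    V.IsPrimitive (B.map f.toHom) (f '' X) ↔ V.IsPrimitive B X := by
  constructor
  · rintro ⟨Y, hXY, hY⟩
    obtain ⟨Y, -, rfl⟩ := Set.subset_image_iff.1 (hY.subset : Y ⊆ f '' B)
    exact ⟨Y, (Set.image_subset_image_iff f.injective).1 hXY, (isBasisOf_map_iff f).1 hY⟩
  · rintro ⟨Y, hXY, hY⟩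
    exact ⟨f '' Y, Set.image_mono hXY, (isBasisOf_map_iff f).2 hY⟩

variable [L.IsAlgebraic]

theorem isBasis_iff_isBasisOf {Y : Set S} :
    V.IsBasis S Y ↔ V.IsBasisOf S (((↑) : S → M) '' Y) := by
  have hindep : V.IsIndep (((↑) : S → M) '' Y) ↔ V.IsIndep Y := isIndep_image_iff S.subtype
  constructor
  · rintro ⟨hS, hcl, hY⟩
    refine ⟨hS, hindep.2 (isIndep_of_exists_hom (S := ⊤) (Set.subset_univ Y) fun N _ hN f => ?_),
      closure_image_coe_eq_iff.2 hcl⟩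
    obtain ⟨g, hg⟩ := hY N hN f
    exact ⟨g.comp (⊤ : L.Substructure S).subtype.toHom, hg⟩
  · rintro ⟨hS, hY, hcl⟩
    have htop : closure L Y = ⊤ := closure_image_coe_eq_iff.1 hcl
    refine ⟨hS, htop, fun N _ hN f => ?_⟩
    obtain ⟨g, hg⟩ := (hindep.1 hY).exists_hom hN f
    exact ⟨g.comp (Hom.id L S |>.codRestrict _ fun x => htop ▸ mem_top x), hg⟩

theorem IsBasisOf.isBasis (h : V.IsBasisOf S X) : V.IsBasis S (((↑) : S → M) ⁻¹' X) := by
  rw [isBasis_iff_isBasisOf, Set.image_preimage_eq_of_subset]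
  · exact h
  · exact h.subset.trans Subtype.range_coe.ge

theorem isFree_iff : V.IsFree S ↔ ∃ X, V.IsBasisOf S X :=
  ⟨fun ⟨_, hY⟩ => ⟨_, isBasis_iff_isBasisOf.1 hY⟩, fun ⟨_, hX⟩ => ⟨_, hX.isBasis⟩⟩

theorem IsBasisOf.isFree (h : V.IsBasisOf S X) : V.IsFree S :=
  ⟨_, h.isBasis⟩

theorem isFreeFin_iff : V.IsFreeFin S ↔ ∃ X, X.Finite ∧ V.IsBasisOf S X :=
  ⟨fun ⟨_, hY, hfin⟩ => ⟨_, hfin.image _, isBasis_iff_isBasisOf.1 hY⟩,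
    fun ⟨_, hfin, hX⟩ => ⟨_, hX.isBasis, hfin.preimage Subtype.val_injective.injOn⟩⟩

theorem IsBasisOf.isFreeOfRank (h : V.IsBasisOf S X) (hfin : X.Finite) :
    V.IsFreeOfRank S X.ncard := by
  refine ⟨_, h.isBasis, ?_⟩
  rw [hfin.cast_ncard_eq]
  exact Set.encard_preimage_of_injective_subset_range Subtype.val_injective
    (Subtype.range_coe.symm ▸ h.subset)

end Bases

section FreeFactors

variable {V} {M : Type u} [L.Structure M] {A B C P : L.Substructure M} {X Y Z : Set M}

theorem FreeFactor.le (h : V.FreeFactor A B) : A ≤ B := by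
  obtain ⟨-, -, C, -, -, rfl, -⟩ := h
  exact le_sup_left

theorem IsFreeProduct.isFreeAmalgam_bot (h : V.IsFreeProduct A C P) : V.IsFreeAmalgam ⊥ A C P :=
  ⟨bot_le, bot_le, h.1, h.2.1, fun N _ hN f g _ => h.2.2 N hN f g⟩

theorem isFreeProduct_bot (hB : V.Mem B) : V.IsFreeProduct B ⊥ B := by
  rw [← Substructure.closure_empty]
  refine ⟨hB, by rw [Substructure.closure_empty, sup_bot_eq], fun N _ _ f g =>
    ⟨f, fun _ _ _ => rfl, ?_⟩⟩
  have hg : f.comp (inclusion (closure_le.2 (Set.empty_subset _))).toHom = g :=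
    hom_closure_ext fun _ hx => hx.elim
  exact fun x hx _ => DFunLike.congr_fun hg ⟨x, hx⟩

variable [L.IsAlgebraic]

theorem IsFreeAmalgam.isBasisOf_union (h : V.IsFreeAmalgam (closure L X) B C P) (hXY : X ⊆ Y)
    (hXZ : X ⊆ Z) (hY : V.IsBasisOf B Y) (hZ : V.IsBasisOf C Z) : V.IsBasisOf P (Y ∪ Z) := by
  obtain ⟨-, -, hP, rfl, hlift⟩ := h
  obtain ⟨-, hY, rfl⟩ := hY
  obtain ⟨-, hZ, rfl⟩ := hZ
  have hcl : closure L (Y ∪ Z) = closure L Y ⊔ closure L Z := closure_union Y Z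
  have hsub : Y ∪ Z ⊆ (closure L Y ⊔ closure L Z : L.Substructure M) :=
    hcl ▸ Substructure.subset_closure
  refine ⟨hP, isIndep_of_exists_hom hsub fun N _ hN f => ?_, hcl⟩
  obtain ⟨g₁, hg₁⟩ := hY.exists_hom hN fun x => f ⟨x, Or.inl x.2⟩
  obtain ⟨g₂, hg₂⟩ := hZ.exists_hom hN fun x => f ⟨x, Or.inr x.2⟩
  have hg : g₁.comp (inclusion (closure_mono hXY)).toHom =
      g₂.comp (inclusion (closure_mono hXZ)).toHom :=
    hom_closure_ext fun x hx => (hg₁ ⟨x, hXY hx⟩).trans (hg₂ ⟨x, hXZ hx⟩).symm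
  obtain ⟨g, h₁, h₂⟩ := hlift N hN g₁ g₂ fun x _ _ hx => DFunLike.congr_fun hg ⟨x, hx⟩
  refine ⟨g, ?_⟩
  rintro ⟨x, hx | hx⟩
  · exact (h₁ x (subset_closure hx) _).trans (hg₁ ⟨x, hx⟩)
  · exact (h₂ x (subset_closure hx) _).trans (hg₂ ⟨x, hx⟩)

theorem IsBasisOf.isFreeProduct (hB : V.IsBasisOf B (X ∪ Y)) (hXY : Disjoint X Y) :
    V.IsFreeProduct (closure L X) (closure L Y) B := by
  classical
  obtain ⟨hmem, hindep, rfl⟩ := hB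
  refine ⟨hmem, (closure_union X Y).symm, fun N _ hN f g => ?_⟩
  obtain ⟨h, hh⟩ := hindep.exists_hom hN fun x => if hx : (x : M) ∈ X then
    f ⟨x, subset_closure hx⟩ else g ⟨x, subset_closure (x.2.resolve_left hx)⟩
  have hf : h.comp (inclusion (closure_mono Set.subset_union_left)).toHom = f :=
    hom_closure_ext fun x hx => (hh ⟨x, Or.inl hx⟩).trans (dif_pos hx)
  have hg : h.comp (inclusion (closure_mono Set.subset_union_right)).toHom = g :=
    hom_closure_ext fun x hx => (hh ⟨x, Or.inr hx⟩).trans (dif_neg (Set.disjoint_right.1 hXY hx))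
  exact ⟨h, fun x hx _ => DFunLike.congr_fun hf ⟨x, hx⟩,
    fun x hx _ => DFunLike.congr_fun hg ⟨x, hx⟩⟩

theorem IsPrimitive.freeFactor (h : V.IsPrimitive B X) : V.FreeFactor (closure L X) B := by
  obtain ⟨Y, hXY, hY⟩ := h
  refine ⟨(hY.closure_of_subset hXY).isFree, hY.isFree, closure L (Y \ X),
    (hY.closure_of_subset Set.sdiff_subset).isFree, ?_⟩
  exact IsBasisOf.isFreeProduct (by rwa [Set.union_sdiff_cancel hXY]) Set.disjoint_sdiff_right

theorem FreeFactor.isPrimitive (h : V.FreeFactor A B) (hX : V.IsBasisOf A X) :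
    V.IsPrimitive B X := by
  obtain ⟨-, -, C, hC, hprod⟩ := h
  obtain ⟨Y, hY⟩ := isFree_iff.1 hC
  have hamalgam := hprod.isFreeAmalgam_bot
  rw [← Substructure.closure_empty] at hamalgam
  exact ⟨X ∪ Y, Set.subset_union_left,
    hamalgam.isBasisOf_union (Set.empty_subset X) (Set.empty_subset Y) hX hY⟩

theorem FreeFactor.exists_finite_isBasisOf (h : V.FreeFactor A B) (hB : V.IsFreeFin B)
    (hX : V.IsBasisOf A X) (hfin : X.Finite) : ∃ Z, X ⊆ Z ∧ Z.Finite ∧ V.IsBasisOf B Z := by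
  obtain ⟨Y, hXY, hY⟩ := h.isPrimitive hX
  obtain ⟨F, hF, hFB⟩ := isFreeFin_iff.1 hB
  obtain ⟨Z, hZY, hZ, hFZ⟩ := exists_finite_subset_subset_closure (L := L) (Y := Y) hF
    (hY.closure_eq ▸ hFB.subset)
  have hXZ : X ∪ Z ⊆ Y := Set.union_subset hXY hZY
  refine ⟨X ∪ Z, Set.subset_union_left, hfin.union hZ, hY.mem, hY.isIndep.mono hXZ,
    closure_eq_of_le (hXZ.trans hY.subset) ?_⟩
  rw [← hFB.closure_eq, closure_le]
  exact hFZ.trans (closure_mono Set.subset_union_right)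

theorem ConstructionPrinciple.exists_isPrimitive_chain (hV : ConstructionPrinciple.{u} V) :
    ∃ (B : Type u) (_ : L.Structure B) (X : ℕ → Set B), Countable B ∧ V.IsFreeInf B ∧
      Monotone X ∧ (∀ i, (X i).Finite) ∧ (⋃ i, X i).Infinite ∧
      (∀ i, V.IsPrimitive ⊤ (X i)) ∧ ¬ V.IsPrimitive ⊤ (⋃ i, X i) := by
  obtain ⟨B, _, A, a, hcount, hinf, ha, hA, hfactor, hnot⟩ := hV
  let b (i : ℕ) : B := a i
  have hX (i : ℕ) : b '' Set.Iic i = {x : B | ∃ j ≤ i, x = a j} := by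
    ext x
    simp only [b, Set.mem_image, Set.mem_Iic, Set.mem_ofPred_eq, eq_comm]
  have hXA : V.IsBasisOf A (⋃ i, b '' Set.Iic i) := by
    rw [← Set.image_iUnion, Set.iUnion_Iic, Set.image_univ, Set.range_comp' (g := Subtype.val)]
    exact isBasis_iff_isBasisOf.1 hA
  refine ⟨B, _, fun i => b '' Set.Iic i, hcount, hinf,
    fun i j hij => Set.image_mono (Set.Iic_subset_Iic.2 hij),
    fun i => (Set.finite_Iic i).image b, ?_, fun i => ?_, fun hprim => ?_⟩
  · rw [← Set.image_iUnion, Set.iUnion_Iic, Set.image_univ]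
    exact Set.infinite_range_of_injective (Subtype.val_injective.comp ha)
  · have hfactor' : V.FreeFactor (closure L (b '' Set.Iic i)) ⊤ := by
      rw [hX]
      exact hfactor i
    exact hfactor'.isPrimitive
      (hXA.closure_of_subset (Set.subset_iUnion (fun i => b '' Set.Iic i) i))
  · obtain ⟨Y, -, hY⟩ := id hprim
    have hrange : (Embedding.refl L B).toHom.range = ⊤ := Hom.range_id
    have hmap : A.map (Embedding.refl L B).toHom = A := A.map_id
    refine hnot B (Embedding.refl L B) ⊥ ?_
      (by simpa only [hrange] using isFreeProduct_bot hY.mem) ?_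
    · rw [← Substructure.closure_empty]
      exact (hY.closure_of_subset (Set.empty_subset Y)).isFree
    · rw [hmap, ← hXA.closure_eq]
      exact hprim.freeFactor

end FreeFactors

section Absorption

/-- The finite set `Y` is part of a complement, in a basis of `B`, of almost all members of the
sequence `X`. -/
def IsPartialComplement {M : Type u} [L.Structure M] (B : L.Substructure M) (X : ℕ → Set M)
    (Y : Set M) : Prop :=
  Y.Finite ∧ ∀ᶠ j in atTop, V.IsPrimitive B (X j ∪ Y)

variable {V} {M : Type u} [L.Structure M] {B : L.Substructure M} {X : ℕ → Set M} {Y : Set M}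

theorem IsPartialComplement.isIndep_iUnion_union (hX : Monotone X)
    (h : V.IsPartialComplement B X Y) : V.IsIndep ((⋃ j, X j) ∪ Y) := by
  obtain ⟨i, hi⟩ := eventually_atTop.1 h.2
  have hshift : ⋃ j, X (j + i) = ⋃ j, X j := hX.iUnion_nat_add i
  rw [← hshift, Set.iUnion_union]
  refine isIndep_iUnion (fun j k hjk => ?_) fun j =>
    (hi (j + i) (Nat.le_add_left i j)).isBasisOf_closure.isIndep
  exact Set.union_subset_union_left Y (hX (Nat.add_le_add_right hjk i))

theorem isPrimitive_iUnion_of_forall_absorb [Countable B] (hX : Monotone X)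
    (hprim : ∀ j, V.IsPrimitive B (X j))
    (habsorb : ∀ Y, V.IsPartialComplement B X Y → ∀ b ∈ B,
      ∃ Z, Y ⊆ Z ∧ V.IsPartialComplement B X Z ∧ b ∈ closure L Z) :
    V.IsPrimitive B (⋃ j, X j) := by
  have := Encodable.ofCountable B
  let start : {Y // V.IsPartialComplement B X Y} :=
    ⟨∅, Set.finite_empty, by simpa only [Set.union_empty] using Eventually.of_forall hprim⟩
  let absorbing (b : B) : Order.Cofinal {Y // V.IsPartialComplement B X Y} :=
    { carrier := {Y | (b : M) ∈ closure L (Y : Set M)}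
      isCofinal := fun ⟨Y, hY⟩ =>
        let ⟨Z, hYZ, hZ, hb⟩ := habsorb Y hY b b.2
        ⟨⟨Z, hZ⟩, hb, hYZ⟩ }
  let Y (k : ℕ) : Set M := (Order.sequenceOfCofinals start absorbing k).1
  have hYmono : Monotone Y := Order.sequenceOfCofinals.monotone start absorbing
  have hY (k : ℕ) : V.IsPartialComplement B X (Y k) :=
    (Order.sequenceOfCofinals start absorbing k).2
  have hBY (b : B) : (b : M) ∈ closure L (Y (Encodable.encode b + 1)) :=
    Order.sequenceOfCofinals.encode_mem start absorbing b
  have hsub (k : ℕ) : Y k ⊆ B := by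
    obtain ⟨j, W, hW, hWB⟩ := (hY k).2.exists
    exact Set.subset_union_right.trans (hW.trans hWB.subset)
  have hXsub (j : ℕ) : X j ⊆ B := by
    obtain ⟨W, hW, hWB⟩ := hprim j
    exact hW.trans hWB.subset
  obtain ⟨W, -, hWB⟩ := hprim 0
  refine ⟨⋃ k, (⋃ j, X j) ∪ Y k, ?_, hWB.mem, isIndep_iUnion (fun k l hkl => ?_) fun k =>
    (hY k).isIndep_iUnion_union hX, closure_eq_of_le ?_ fun b hb => ?_⟩
  · exact Set.subset_iUnion_of_subset 0 Set.subset_union_left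
  · exact Set.union_subset_union_right _ (hYmono hkl)
  · exact Set.iUnion_subset fun k => Set.union_subset (Set.iUnion_subset hXsub) (hsub k)
  · have hYW : Y (Encodable.encode (⟨b, hb⟩ : B) + 1) ⊆ ⋃ k, (⋃ j, X j) ∪ Y k :=
      Set.subset_iUnion_of_subset _ Set.subset_union_right
    exact closure_mono hYW (hBY ⟨b, hb⟩)

end Absorption

end AlgVariety

section Chains

variable {L : FirstOrder.Language.{v, w}} {M : Type u} [L.Structure M] {K : StrongClass.{u} L}
  {E : ℕ → L.Substructure M}

/-- The sequence `E`, when increasing, as a chain indexed by the ordinals that reaches its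
supremum at `ω`. -/
def ordinalChain (E : ℕ → L.Substructure M) (α : Ordinal.{u}) : L.Substructure M :=
  ⨆ (n : ℕ) (_ : (n : Ordinal.{u}) ≤ α), E n

theorem ordinalChain_natCast (hE : Monotone E) (n : ℕ) : ordinalChain E n = E n :=
  le_antisymm (iSup₂_le fun _ hm => hE (Nat.cast_le.1 hm)) (le_iSup₂_of_le n le_rfl le_rfl)

theorem ordinalChain_omega0 : ordinalChain E Ordinal.omega0 = ⨆ n, E n :=
  iSup_congr fun n => iSup_pos (Ordinal.natCast_lt_omega0 n).le

theorem coe_iSup_eq_iUnion_ordinalChain (hE : Monotone E) :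
    ((⨆ n, E n : L.Substructure M) : Set M) =
      ⋃ i < Ordinal.omega0.{u}, (ordinalChain E i : Set M) := by
  rw [coe_iSup_of_monotone hE]
  refine Set.Subset.antisymm (Set.iUnion_subset fun n => ?_) (Set.iUnion₂_subset fun i hi => ?_)
  · refine Set.subset_iUnion₂_of_subset n (Ordinal.natCast_lt_omega0 n) ?_
    rw [ordinalChain_natCast hE]
  · obtain ⟨n, rfl⟩ := Ordinal.lt_omega0.1 hi
    rw [ordinalChain_natCast hE]
    exact Set.subset_iUnion (fun n => (E n : Set M)) n

theorem StrongClass.IsAEC.isContinuousChain_ordinalChain (hK : K.IsAEC) (hE : Monotone E)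
    (hstrong : ∀ n, K.strong M (E n)) :
    K.IsContinuousChain Ordinal.omega0 (ordinalChain E) where
  mem i hi := by
    obtain ⟨n, rfl⟩ := Ordinal.lt_omega0.1 hi
    rw [ordinalChain_natCast hE]
    exact (hK.mem_of_strong M _ (hstrong n)).2
  strongIn i j hij hj := by
    obtain ⟨n, rfl⟩ := Ordinal.lt_omega0.1 hj
    obtain ⟨m, rfl⟩ := Ordinal.lt_omega0.1 (hij.trans_lt hj)
    rw [ordinalChain_natCast hE, ordinalChain_natCast hE]
    exact hK.coherence M _ _ (hstrong m) (hstrong n) (hE (Nat.cast_le.1 hij))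
  continuous j hj hlim := absurd (Ordinal.omega0_le_of_isSuccLimit hlim) hj.not_ge

theorem StrongClass.IsAEC.strong_iSup (hK : K.IsAEC) (hE : Monotone E)
    (hstrong : ∀ n, K.strong M (E n)) : K.strong M (⨆ n, E n) := by
  refine (hK.union M Ordinal.omega0 (ordinalChain E) _ Ordinal.isSuccLimit_omega0
    (hK.isContinuousChain_ordinalChain hE hstrong)
    (coe_iSup_eq_iUnion_ordinalChain hE)).2.2 fun i hi => ?_
  obtain ⟨n, rfl⟩ := Ordinal.lt_omega0.1 hi
  rw [ordinalChain_natCast hE]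
  exact hstrong n

theorem SuperstableLocalCharacter.exists_nat {κ : Cardinal.{u}} {ind : TernaryRel L M}
    (h : SuperstableLocalCharacter K κ M ind) (hK : K.IsAEC) (hE : Monotone E)
    (hstrong : ∀ n, K.strong M (E n)) (hsmall : K.Small κ (⨆ n, E n)) {k : ℕ} (a : Fin k → M) :
    ∃ n, ind a (E n) (⨆ n, E n) := by
  rw [← ordinalChain_omega0] at hsmall ⊢
  obtain ⟨α, hα, ha⟩ := h k Ordinal.omega0 (ordinalChain E) a Ordinal.isSuccLimit_omega0
    (hK.isContinuousChain_ordinalChain hE hstrong)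
    (by rw [ordinalChain_omega0, coe_iSup_eq_iUnion_ordinalChain hE]) hsmall
  obtain ⟨n, rfl⟩ := Ordinal.lt_omega0.1 hα
  exact ⟨n, ordinalChain_natCast hE n ▸ ha⟩

end Chains

section FreeFactorIndependence

variable {L : FirstOrder.Language.{v, w}}

/-- `K` is an abstract elementary class that contains the `V`-free algebras of infinite rank and
those of finite rank at least `n`, and in which free factors are strong substructures.  An
AEC-covering with `(⋆₁)` is of this kind. -/
structure StrongClass.CoversFreeAlgebras (K : StrongClass.{u} L) (V : AlgVariety L) (n : ℕ) :
    Prop where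
  isAEC : K.IsAEC
  mem_of_isFreeInf : ∀ (F : Type u) [L.Structure F], V.IsFreeInf F → K.mem F
  mem_of_isFreeOfRank : ∀ m, n ≤ m → ∀ (F : Type u) [L.Structure F], V.IsFreeOfRank F m → K.mem F
  strongIn_of_freeFactor : ∀ (M : Type u) [L.Structure M] (A B : L.Substructure M),
    K.mem A → K.mem B → V.FreeFactor A B → K.StrongIn A B

/-- `ind` is an independence relation, monotone on the right, that satisfies `(⋆₃)` and `(⋆₄)`:
the part of niceness with respect to free factors that rules out superstability. -/
structure IsFreeFactorIndependence (V : AlgVariety L) (K : StrongClass.{u} L) (κ : Cardinal.{u})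
    {M : Type u} [L.Structure M] (ind : TernaryRel L M) : Prop where
  mono_right : ∀ (n : ℕ) (a : Fin n → M) (A B C : L.Substructure M),
    K.Small κ A → K.Small κ B → K.Small κ C → K.StrongIn A B → K.StrongIn B C →
    ind a A C → ind a A B
  exists_freeFactor : ∀ A B C : L.Substructure M,
    K.Small κ A → K.Small κ B → K.Small κ C →
    V.IsFreeFin A → V.IsFree B → V.IsFree C → K.StrongIn A B → V.FreeFactor A C →
    ∀ c ∈ C, ind ![c] A B →
      ∃ D : L.Substructure M, V.IsFreeFin D ∧ c ∈ D ∧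
        V.FreeFactor A D ∧ V.FreeFactor D C ∧ IndStructure ind D A B
  freeFactor_sup : ∀ A B C D : L.Substructure M,
    K.Small κ A → K.Small κ B → K.Small κ C → K.Small κ D →
    V.IsFreeFin A → V.IsFreeFin B → V.IsFreeFin C → V.IsFree D →
    V.FreeFactor A B → V.FreeFactor B D → V.FreeFactor A C → V.FreeFactor C D →
    IndStructure ind B A C →
      V.IsFreeAmalgam A B C (B ⊔ C) ∧ V.FreeFactor (B ⊔ C) D

variable {V : AlgVariety L} {K : StrongClass.{u} L} {κ : Cardinal.{u}} {M : Type u}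
  [L.Structure M] {ind : TernaryRel L M} {n : ℕ} {B : L.Substructure M}

theorem StrongClass.IsAECCovering.exists_coversFreeAlgebras (hK : K.IsAECCovering V)
    (hnice : IsNiceFreeFactors V K κ M ind) : ∃ n, K.CoversFreeAlgebras V n := by
  obtain ⟨n, hn⟩ := hnice.star1
  exact ⟨n, hK.isAEC, hK.mem_of_isFreeInf, hn, hK.strongIn_of_freeFactor⟩

theorem IsWeakIndependenceCalculus.isFreeFactorIndependence
    (hind : IsWeakIndependenceCalculus K κ M ind) (hK : K.IsAEC)
    (hnice : IsNiceFreeFactors V K κ M ind) : IsFreeFactorIndependence V K κ ind where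
  mono_right k a A B C hA hB hC hAB hBC :=
    hind.monotonicity k a A A B C hA hA hB hC (hK.coherence M A A hA.1 hA.1 le_rfl) hAB hBC
  exists_freeFactor := hnice.star3
  freeFactor_sup := hnice.star4

variable [L.IsAlgebraic]

theorem StrongClass.CoversFreeAlgebras.small_closure (hK : K.CoversFreeAlgebras V n)
    (hB : K.Small κ B) {X : Set M} (hX : V.IsPrimitive B X) (hfin : X.Finite) (hn : n ≤ X.ncard) :
    K.Small κ (closure L X) := by
  have hmem : K.mem (closure L X) :=
    hK.mem_of_isFreeOfRank _ hn _ (hX.isBasisOf_closure.isFreeOfRank hfin)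
  have hstrong : K.StrongIn (closure L X) B :=
    hK.strongIn_of_freeFactor M _ B hmem (hK.isAEC.mem_of_strong M B hB.1).2 hX.freeFactor
  exact ⟨hK.isAEC.trans M _ B hstrong hB.1, (mk_le_mk_of_subset hstrong.1).trans_lt hB.2⟩

theorem IsFreeFactorIndependence.isPrimitive_union (hind : IsFreeFactorIndependence V K κ ind)
    (hK : K.CoversFreeAlgebras V n) (hB : K.Small κ B) {X Y Z : Set M} (hXY : X ⊆ Y) (hXZ : X ⊆ Z)
    (hY : V.IsPrimitive B Y) (hZ : V.IsPrimitive B Z) (hYfin : Y.Finite) (hZfin : Z.Finite)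
    (hn : n ≤ X.ncard) (h : IndStructure ind (closure L Y) (closure L X) (closure L Z)) :
    V.IsPrimitive B (Y ∪ Z) := by
  obtain ⟨W, hYW, hW⟩ := id hY
  have hX : V.IsPrimitive B X := ⟨W, hXY.trans hYW, hW⟩
  have hXfin : X.Finite := hYfin.subset hXY
  obtain ⟨hamalgam, hfactor⟩ := hind.freeFactor_sup _ _ _ _
    (hK.small_closure hB hX hXfin hn)
    (hK.small_closure hB hY hYfin (hn.trans (Set.ncard_le_ncard hXY hYfin)))
    (hK.small_closure hB hZ hZfin (hn.trans (Set.ncard_le_ncard hXZ hZfin))) hB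
    (AlgVariety.isFreeFin_iff.2 ⟨X, hXfin, hX.isBasisOf_closure⟩)
    (AlgVariety.isFreeFin_iff.2 ⟨Y, hYfin, hY.isBasisOf_closure⟩)
    (AlgVariety.isFreeFin_iff.2 ⟨Z, hZfin, hZ.isBasisOf_closure⟩) hW.isFree
    (AlgVariety.IsPrimitive.freeFactor ⟨Y, hXY, hY.isBasisOf_closure⟩) hY.freeFactor
    (AlgVariety.IsPrimitive.freeFactor ⟨Z, hXZ, hZ.isBasisOf_closure⟩) hZ.freeFactor h
  exact hfactor.isPrimitive
    (hamalgam.isBasisOf_union hXY hXZ hY.isBasisOf_closure hZ.isBasisOf_closure)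

theorem IsFreeFactorIndependence.exists_finite_absorbing
    (hind : IsFreeFactorIndependence V K κ ind) (hK : K.CoversFreeAlgebras V n)
    (hss : SuperstableLocalCharacter K κ M ind) (hB : K.Small κ B) {X : ℕ → Set M}
    (hX : Monotone X) (hfin : ∀ j, (X j).Finite) (hn : ∀ j, n ≤ (X j).ncard)
    (hprim : ∀ j, V.IsPrimitive B (X j)) {b : M} (hb : b ∈ B) :
    ∃ m Z, X m ⊆ Z ∧ Z.Finite ∧ b ∈ closure L Z ∧ ∀ j, m ≤ j → V.IsPrimitive B (X j ∪ Z) := by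
  let E (j : ℕ) : L.Substructure M := closure L (X j)
  have hE : Monotone E := fun _ _ hij => closure_mono (hX hij)
  have hEsmall (j : ℕ) : K.Small κ (E j) := hK.small_closure hB (hprim j) (hfin j) (hn j)
  have hEfactor (j : ℕ) : V.FreeFactor (E j) B := (hprim j).freeFactor
  have hUB : ⨆ j, E j ≤ B := iSup_le fun j => (hEfactor j).le
  have hUsmall : K.Small κ (⨆ j, E j) :=
    ⟨hK.isAEC.strong_iSup hE fun j => (hEsmall j).1, (mk_le_mk_of_subset hUB).trans_lt hB.2⟩
  have hEU (j : ℕ) : K.StrongIn (E j) (⨆ j, E j) :=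
    hK.isAEC.coherence M _ _ (hEsmall j).1 hUsmall.1 (le_iSup E j)
  have hBfree : V.IsFree B := (hEfactor 0).2.1
  have hUbasis : V.IsBasisOf (⨆ j, E j) (⋃ j, X j) := by
    obtain ⟨W, hW⟩ := AlgVariety.isFree_iff.1 hBfree
    exact ⟨hW.mem.of_le hUB,
      AlgVariety.isIndep_iUnion hX fun j => (hprim j).isBasisOf_closure.isIndep, closure_iUnion X⟩
  obtain ⟨m, hm⟩ := hss.exists_nat hK.isAEC hE (fun j => (hEsmall j).1) hUsmall ![b]
  obtain ⟨D, hD, hbD, hmD, hDB, hDind⟩ := hind.exists_freeFactor _ _ _ (hEsmall m) hUsmall hB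
    (AlgVariety.isFreeFin_iff.2 ⟨_, hfin m, (hprim m).isBasisOf_closure⟩) hUbasis.isFree hBfree
    (hEU m) (hEfactor m) b hb hm
  obtain ⟨Z, hXZ, hZfin, hZ⟩ :=
    hmD.exists_finite_isBasisOf hD (hprim m).isBasisOf_closure (hfin m)
  refine ⟨m, Z, hXZ, hZfin, hZ.closure_eq ▸ hbD, fun j hj => ?_⟩
  have hjind : IndStructure ind (closure L Z) (E m) (E j) := fun k c hc =>
    hind.mono_right k c _ _ _ (hEsmall m) (hEsmall j) hUsmall
      (hK.isAEC.coherence M _ _ (hEsmall m).1 (hEsmall j).1 (hE hj)) (hEU j)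
      (hDind k c (hZ.closure_eq ▸ hc))
  rw [Set.union_comm]
  exact hind.isPrimitive_union hK hB hXZ (hX hj) (hDB.isPrimitive hZ) (hprim j) hZfin (hfin j)
    (hn m) hjind

theorem IsFreeFactorIndependence.exists_isPartialComplement_absorbing
    (hind : IsFreeFactorIndependence V K κ ind) (hK : K.CoversFreeAlgebras V n)
    (hss : SuperstableLocalCharacter K κ M ind) (hB : K.Small κ B) {X : ℕ → Set M}
    (hX : Monotone X) (hfin : ∀ j, (X j).Finite) (hinf : (⋃ j, X j).Infinite) {Y : Set M}
    (hY : V.IsPartialComplement B X Y) {b : M} (hb : b ∈ B) :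
    ∃ Z, Y ⊆ Z ∧ V.IsPartialComplement B X Z ∧ b ∈ closure L Z := by
  have hrank : ∃ i, n ≤ (X i).ncard := by
    obtain ⟨F, hF, hFfin, rfl⟩ := hinf.exists_subset_ncard_eq n
    lift F to Finset M using hFfin
    obtain ⟨i, hi⟩ := hX.directed_le.exists_mem_subset_of_finset_subset_biUnion hF
    exact ⟨i, Set.ncard_le_ncard hi (hfin i)⟩
  obtain ⟨i₀, hi₀⟩ := hrank
  obtain ⟨i₁, hi₁⟩ := eventually_atTop.1 hY.2
  let i := max i₀ i₁
  have hX'fin (j : ℕ) : (X (i + j) ∪ Y).Finite := (hfin _).union hY.1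
  obtain ⟨m, Z, hXZ, hZfin, hbZ, hZ⟩ := hind.exists_finite_absorbing hK hss hB
    (X := fun j => X (i + j) ∪ Y)
    (fun j k hjk => Set.union_subset_union_left Y (hX (Nat.add_le_add_left hjk i))) hX'fin
    (fun j => hi₀.trans (Set.ncard_le_ncard
      ((hX (by omega : i₀ ≤ i + j)).trans Set.subset_union_left) (hX'fin j)))
    (fun j => hi₁ (i + j) (by omega)) hb
  have hYZ : Y ⊆ Z := Set.subset_union_right.trans hXZ
  refine ⟨Z, hYZ, ⟨hZfin, eventually_atTop.2 ⟨i + m, fun j hj => ?_⟩⟩, hbZ⟩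
  obtain ⟨j, rfl⟩ := Nat.exists_eq_add_of_le (show i ≤ j by omega)
  simpa only [Set.union_assoc, Set.union_eq_self_of_subset_left hYZ] using hZ j (by omega)

theorem IsFreeFactorIndependence.isPrimitive_iUnion (hind : IsFreeFactorIndependence V K κ ind)
    (hK : K.CoversFreeAlgebras V n) (hss : SuperstableLocalCharacter K κ M ind)
    (hB : K.Small κ B) [Countable B] {X : ℕ → Set M} (hX : Monotone X) (hfin : ∀ j, (X j).Finite)
    (hinf : (⋃ j, X j).Infinite) (hprim : ∀ j, V.IsPrimitive B (X j)) :
    V.IsPrimitive B (⋃ j, X j) :=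
  AlgVariety.isPrimitive_iUnion_of_forall_absorb hX hprim fun _ hY _ hb =>
    hind.exists_isPartialComplement_absorbing hK hss hB hX hfin hinf hY hb

end FreeFactorIndependence

theorem theorem1p10_general {L : FirstOrder.Language.{v, w}} [L.IsAlgebraic]
    (V : AlgVariety L) (hV : AlgVariety.ConstructionPrinciple.{u} V)
    (K : StrongClass.{u} L) (n : ℕ) (hK : K.CoversFreeAlgebras V n)
    (κ : Cardinal.{u}) (hκ : ℵ₀ < κ) (M : Type u) [L.Structure M]
    (hM : ∀ (C : Type u) [L.Structure C] [Countable C], K.mem C →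
      ∃ f : C ↪[L] M, K.IsStrongEmbedding f)
    (ind : TernaryRel L M) (hind : IsFreeFactorIndependence V K κ ind) :
    ¬ SuperstableLocalCharacter K κ M ind := by
  intro hss
  obtain ⟨B, _, X, _, hBinf, hX, hfin, hinf, hprim, hnot⟩ := hV.exists_isPrimitive_chain
  obtain ⟨f, hf⟩ := hM B (hK.mem_of_isFreeInf B hBinf)
  have hrange : f.toHom.range = (⊤ : L.Substructure B).map f.toHom := Hom.range_eq_map _
  have : Countable f.toHom.range := f.equivRange.toEquiv.symm.injective.countable
  have hsmall : K.Small κ f.toHom.range := ⟨hf, mk_le_aleph0.trans_lt hκ⟩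
  have hunion : V.IsPrimitive f.toHom.range (⋃ i, f '' X i) :=
    hind.isPrimitive_iUnion hK hss hsmall (fun i j hij => Set.image_mono (hX hij))
      (fun i => (hfin i).image f)
      (by simpa only [← Set.image_iUnion] using hinf.image f.injective.injOn)
      fun i => by simpa only [hrange] using (AlgVariety.isPrimitive_map_iff f).2 (hprim i)
  rw [← Set.image_iUnion, hrange, AlgVariety.isPrimitive_map_iff] at hunion
  exact hnot hunion

theorem theorem1p10 {L : FirstOrder.Language.{v, w}} [L.IsAlgebraic]
    [Countable (Σ n, L.Functions n)]
    (V : AlgVariety L) (hV : AlgVariety.ConstructionPrinciple.{u} V)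
    (K : StrongClass.{u} L) (hK : K.IsAECCovering V)
    (lam κ : Cardinal.{u}) (hlam : K.IsLSNumber lam) (hκ : lam < κ)
    (M : Type u) [L.Structure M] (hM : K.IsMonster κ M)
    (ind : TernaryRel L M) (hind : IsWeakIndependenceCalculus K κ M ind)
    (hnice : IsNiceFreeFactors V K κ M ind) :
    ¬ SuperstableLocalCharacter K κ M ind := by
  obtain ⟨n, hn⟩ := hK.exists_coversFreeAlgebras hnice
  exact theorem1p10_general V hV K n hn κ (hlam.1.trans_lt hκ) M
    (fun C _ _ hC => hM.universal C hC (mk_le_aleph0.trans (hlam.1.trans hκ.le)))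
    ind (hind.isFreeFactorIndependence hK.isAEC hnice)
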